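/- Fix an integer $k\ge 2$. Work in the field $\mathbb{C}((q))$ of formal Laurent series. Define series $B_r$ ($r\ge 1$, the official series) and $\tilde B_r$ ($r\ge 2$, the ghost series) as follows. For $1\le i\le k$ let \[ B_i=\frac{\prod_{m\ge 1}(1-q^{2km})(1-q^{2km-k+i-1})(1-q^{2km-k-i+1})}{\prod_{m\ge1}(1-q^m)} . \] For $j=0,1,2,\dots$ in turn, once $B_{(k-1)j+1},\dots,B_{(k-1)j+k}$ are known, let \[ \tilde B_{(k-1)j+i}=\frac{B_{(k-1)j+i-1}+q^{j+1}B_{(k-1)j+i+1}}{1+q^{j+1}}\quad(2\le i\le k-1),\qquad \tilde B_{(k-1)j+k}=\frac{B_{(k-1)j+k-1}}{1+q^{j+1}}, \] and then \[ B_{(k-1)(j+1)+i}=\frac{B_{(k-1)j+k-i+1}-\tilde B_{(k-1)j+k-i+2}}{q^{(j+1)(i-1)}}\quad(2\le i\le k). \] Theorem. Let $J\ge 0$, $2\le i\le k$ and $r=(k-1)J+i$. Then $\tilde B_r$ is a formal power series, and \[ \tilde B_r=\sum_{n\ge 0}\tilde b_{k,r}(n)\,q^n , \] where $\tilde b_{k,r}(n)$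 is the number of partitions $\pi=(\pi_1\ge\pi_2\ge\dots\ge\pi_{\ell(\pi)}\ge 1)$ of $n$ such that (1) $\pi_t-\pi_{t+k-1}\ge 2$ for all $t\ge1$ with $t+k-1\le\ell(\pi)$; (2) every part of $\pi$ is at least $J+1$; (3) the part $J+1$ occurs at most $k-i$ times in $\pi$; (4) for all $t\ge1$ with $t+k-2\le\ell(\pi)$, if $\pi_t-\pi_{t+k-2}\le 1$ then $\pi_t+\pi_{t+1}+\dots+\pi_{t+k-2}\equiv r+k+1\pmod 2$. -/

import Mathlib

namespace GhostSeries

open PowerSeries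
open scoped PowerSeries.WithPiTopology

/-- The formal variable `q`, in the field `ℂ((q))` of formal Laurent series. -/
noncomputable def q : LaurentSeries ℂ := ((X : PowerSeries ℂ) : LaurentSeries ℂ)

/-- `(q)_∞ = ∏_{m ≥ 1} (1 - q ^ m)` as a formal power series (the product index is shifted by one,
and the infinite product is taken coefficientwise). -/
noncomputable def qInf : PowerSeries ℂ := ∏' m : ℕ, (1 - X ^ (m + 1))

/-- The numerator `∏_{m ≥ 1} (1 - q^{2km}) (1 - q^{2km-k+i-1}) (1 - q^{2km-k-i+1})` of the product
side. The product index is shifted by one (`m + 1` in place of `m`), so that for `1 ≤ i ≤ k` no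
subtraction truncates and all exponents are positive. -/
noncomputable def numProd (k i : ℕ) : PowerSeries ℂ :=
  ∏' m : ℕ, ((1 - X ^ (2 * k * (m + 1))) * (1 - X ^ (2 * k * (m + 1) - k + i - 1)) *
    (1 - X ^ (2 * k * (m + 1) - k - i + 1)))

/-- The zeroth-shelf official series `B_i`, `1 ≤ i ≤ k`. -/
noncomputable def zerothShelf (k i : ℕ) : LaurentSeries ℂ :=
  (numProd k i : LaurentSeries ℂ) / (qInf : LaurentSeries ℂ)

/-- Given the official series `b 1, …, b k` on the `j`-th shelf, the ghost series at position
`i ∈ {2, …, k}` on the `j`-th shelf. -/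
noncomputable def ghostOfShelf (k j : ℕ) (b : ℕ → LaurentSeries ℂ) (i : ℕ) : LaurentSeries ℂ :=
  if i = k then b (k - 1) / (1 + q ^ (j + 1))
  else (b (i - 1) + q ^ (j + 1) * b (i + 1)) / (1 + q ^ (j + 1))

/-- `officialShelf k j i` is the official series at position `i ∈ {1, …, k}` on the `j`-th shelf.
The last position of a shelf is the first position of the next one. -/
noncomputable def officialShelf (k : ℕ) : ℕ → ℕ → LaurentSeries ℂ
  | 0, i => zerothShelf k i
  | j + 1, i =>
    if i = 1 then officialShelf k j k
    else (officialShelf k j (k - i + 1) - ghostOfShelf k j (officialShelf k j) (k - i + 2)) /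
      q ^ ((j + 1) * (i - 1))

/-- The official series `B_r`, `r ≥ 1`, for given `k ≥ 2`. -/
noncomputable def official (k r : ℕ) : LaurentSeries ℂ :=
  officialShelf k ((r - 1) / (k - 1)) ((r - 1) % (k - 1) + 1)

/-- The ghost series `B̃_r`, `r ≥ 2`, for given `k ≥ 2`: here `r = (k - 1) j + i` with
`j = (r - 2) / (k - 1)` and `i = (r - 2) % (k - 1) + 2 ∈ {2, …, k}`. -/
noncomputable def ghost (k r : ℕ) : LaurentSeries ℂ :=
  ghostOfShelf k ((r - 2) / (k - 1)) (officialShelf k ((r - 2) / (k - 1)))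
    ((r - 2) % (k - 1) + 2)

/-- The parts of a partition, as a nonincreasing list. -/
noncomputable def sortedParts {n : ℕ} (π : n.Partition) : List ℕ :=
  π.parts.sort (· ≥ ·)

/-- The `t`-th largest part `π_t` of a partition, counted from `t = 0`; only used for
`t < ℓ(π) = π.parts.card`. -/
noncomputable def part {n : ℕ} (π : n.Partition) (t : ℕ) : ℕ :=
  (sortedParts π).getD t 0

/-- The conditions on a partition for a given `k`, shelf `J`, position `i` and parity residue `c`;
the indices `t` are those for which all parts that are mentioned exist. -/
structure Admissible (k J i c : ℕ) {n : ℕ} (π : n.Partition) : Prop where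
  /-- `π_t - π_{t+k-1} ≥ 2` -/
  difference : ∀ t, t + (k - 1) < π.parts.card → part π (t + (k - 1)) + 2 ≤ part π t
  /-- every part, equivalently the smallest one, is at least `J + 1` -/
  smallest : ∀ p ∈ π.parts, J + 1 ≤ p
  /-- the multiplicity of `J + 1` is at most `k - i` -/
  multiplicity : π.parts.count (J + 1) ≤ k - i
  /-- `π_t - π_{t+k-2} ≤ 1` only if `π_t + π_{t+1} + ⋯ + π_{t+k-2} ≡ c (mod 2)` -/
  parity : ∀ t, t + (k - 2) < π.parts.card → part π t ≤ part π (t + (k - 2)) + 1 →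
    (∑ s ∈ Finset.range (k - 1), part π (t + s)) ≡ c [MOD 2]

/-- `b̃_{k,r}(n)` for `r = (k - 1) J + i`: the number of partitions of `n` that satisfy the
conditions with parity residue `r + k + 1`. -/
noncomputable def ghostCount (k J i n : ℕ) : ℕ :=
  Nat.card {π : n.Partition // Admissible k J i ((k - 1) * J + i + k + 1) π}

/-! The remaining facts check the definitions: the infinite products converge, and the two families
satisfy the two-sided relations between consecutive shelves. -/

theorem multipliable_one_sub_X_pow_of_lt (a : ℕ → ℕ) (ha : ∀ m, m < a m) :
    Multipliable fun m : ℕ => (1 - X ^ a m : PowerSeries ℂ) := by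
  simp_rw [sub_eq_add_neg]
  apply WithPiTopology.multipliable_one_add_of_tendsto_order_atTop_nhds_top
  refine ENat.tendsto_nhds_top_iff_natCast_lt.mpr
    (fun n => Filter.eventually_atTop.mpr ⟨n, fun m hm => ?_⟩)
  rw [order_neg, order_X_pow]
  exact_mod_cast lt_of_le_of_lt hm (ha m)

theorem multipliable_qInf : Multipliable fun m : ℕ => (1 - X ^ (m + 1) : PowerSeries ℂ) :=
  multipliable_one_sub_X_pow_of_lt _ fun m => Nat.lt_succ_self m

theorem multipliable_numProd (k i : ℕ) (hi : 1 ≤ i) (hik : i ≤ k) :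
    Multipliable fun m : ℕ => ((1 - X ^ (2 * k * (m + 1))) *
      (1 - X ^ (2 * k * (m + 1) - k + i - 1)) * (1 - X ^ (2 * k * (m + 1) - k - i + 1)) :
        PowerSeries ℂ) := by
  have key : ∀ m : ℕ, 2 * k + 2 * m ≤ 2 * k * (m + 1) ∧ k + m ≤ 2 * k * (m + 1) - k := by
    intro m
    have h : m * 1 ≤ m * k := Nat.mul_le_mul_left m (le_trans hi hik)
    have h2 : 2 * k * (m + 1) = 2 * (m * k) + 2 * k := by ring
    omega
  refine ((multipliable_one_sub_X_pow_of_lt _ fun m => ?_).mul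
    (multipliable_one_sub_X_pow_of_lt _ fun m => ?_)).mul
    (multipliable_one_sub_X_pow_of_lt _ fun m => ?_)
  all_goals have := key m; omega

theorem official_eq (k j i : ℕ) (hk : 2 ≤ k) (hi : 1 ≤ i) (hik : i ≤ k) :
    official k ((k - 1) * j + i) = officialShelf k j i := by
  have hpos : 0 < k - 1 := by omega
  rcases Nat.lt_or_ge i k with h | h
  · have e : (k - 1) * j + i - 1 = (i - 1) + (k - 1) * j := by omega
    have hlt : i - 1 < k - 1 := by omega
    simp only [official, e, Nat.add_mul_div_left _ _ hpos, Nat.add_mul_mod_self_left,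
      Nat.div_eq_of_lt hlt, Nat.mod_eq_of_lt hlt, zero_add, Nat.sub_add_cancel hi]
  · obtain rfl : i = k := le_antisymm hik h
    have e : (i - 1) * j + i - 1 = (i - 1) * (j + 1) := by
      rw [Nat.mul_succ]; omega
    simp only [official, e, Nat.mul_div_cancel_left _ hpos, Nat.mul_mod_right, zero_add,
      officialShelf, if_true]

theorem ghost_eq (k j i : ℕ) (hi : 2 ≤ i) (hik : i ≤ k) :
    ghost k ((k - 1) * j + i) = ghostOfShelf k j (officialShelf k j) i := by
  have hpos : 0 < k - 1 := by omega
  have e : (k - 1) * j + i - 2 = (i - 2) + (k - 1) * j := by omega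
  have hlt : i - 2 < k - 1 := by omega
  simp only [ghost, e, Nat.add_mul_div_left _ _ hpos, Nat.add_mul_mod_self_left,
    Nat.div_eq_of_lt hlt, Nat.mod_eq_of_lt hlt, zero_add, Nat.sub_add_cancel hi]

theorem official_zeroth (k i : ℕ) (hk : 2 ≤ k) (hi : 1 ≤ i) (hik : i ≤ k) :
    official k i = zerothShelf k i := by
  simpa [officialShelf] using official_eq k 0 i hk hi hik

theorem q_ne_zero : q ≠ 0 := by
  simp [q]

theorem one_add_q_pow_ne_zero (j : ℕ) : 1 + q ^ (j + 1) ≠ 0 := by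
  intro h
  have h1 : ((1 + X ^ (j + 1) : PowerSeries ℂ) : LaurentSeries ℂ) = ((0 : PowerSeries ℂ) :) := by
    simpa [q] using h
  have h2 := HahnSeries.ofPowerSeries_injective h1
  simpa using congrArg (PowerSeries.constantCoeff (R := ℂ)) h2

theorem relation_edge (k j : ℕ) (hk : 2 ≤ k) :
    official k ((k - 1) * (j + 1) + 2) =
      (official k ((k - 1) * j + (k - 1)) - ghost k ((k - 1) * j + k)) / q ^ (j + 1) ∧
    official k ((k - 1) * (j + 1) + 2) = ghost k ((k - 1) * j + k) := by
  have h1 := one_add_q_pow_ne_zero j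
  have h2 := q_ne_zero
  rw [official_eq k (j + 1) 2 hk (by omega) hk, official_eq k j (k - 1) hk (by omega) (by omega),
    ghost_eq k j k hk le_rfl]
  have e1 : k - 2 + 1 = k - 1 := by omega
  have e2 : k - 2 + 2 = k := by omega
  simp only [officialShelf, e1, e2, ghostOfShelf, if_true]
  refine ⟨by simp, ?_⟩
  norm_num
  field_simp
  ring

theorem shelf_algebra {F : Type*} [Field F] (a b x y : F) (h1 : 1 + a ≠ 0) (ha : a ≠ 0)
    (hb : b ≠ 0) : (x - (x + a * y) / (1 + a)) / (b * a) = ((x + a * y) / (1 + a) - y) / b := by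
  field_simp
  ring

theorem relation_higher (k j i : ℕ) (hi : 3 ≤ i) (hik : i ≤ k) :
    official k ((k - 1) * (j + 1) + i) =
      (official k ((k - 1) * j + (k - i + 1)) - ghost k ((k - 1) * j + (k - i + 2))) /
        q ^ ((j + 1) * (i - 1)) ∧
    official k ((k - 1) * (j + 1) + i) =
      (ghost k ((k - 1) * j + (k - i + 2)) - official k ((k - 1) * j + (k - i + 3))) /
        q ^ ((j + 1) * (i - 2)) := by
  have h1 := one_add_q_pow_ne_zero j
  have h2 := q_ne_zero
  have hk : 2 ≤ k := by omega
  rw [official_eq k (j + 1) i hk (by omega) hik,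
    official_eq k j (k - i + 1) hk (by omega) (by omega),
    official_eq k j (k - i + 3) hk (by omega) (by omega),
    ghost_eq k j (k - i + 2) (by omega) (by omega)]
  have e0 : i ≠ 1 := by omega
  have e1 : k - i + 2 ≠ k := by omega
  have e2 : i - 1 = (i - 2) + 1 := by omega
  have e3 : k - i + 2 - 1 = k - i + 1 := by omega
  simp only [officialShelf, ghostOfShelf, if_neg e0, if_neg e1, e3, true_and]
  rw [e2, Nat.mul_succ, pow_add q ((j + 1) * (i - 2)) (j + 1)]
  exact shelf_algebra _ _ _ _ h1 (pow_ne_zero _ h2) (pow_ne_zero _ h2)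

end GhostSeries

/-!
Write `f_p` for the multiplicity of `p` in a partition. For partitions with parts at least `J + 1`,
the conditions on the differences of parts and on the sums of windows of `k - 1` parts say that
`f_p + f_{p+1} ≤ k - 1` for all `p`, with `p f_p + (p + 1) f_{p+1}` of a prescribed parity in case of
equality (`admissible_iff`). In this form, removing all copies of `J + 1` leads from shelf `J` to
shelf `J + 1`. If there are `m` copies, then `J + 2` may occur up to `k - 1 - m` times or only up
to `k - 2 - m` times, depending on the parity (`shelfExactGF_eq`, `shelfExactGF_eq'`). Since the official and the
ghost conditions have opposite parities, this gives the relations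
`ghostGF_succ_relation` and `officialGF_succ` between the generating functions of the two families,
which are exactly the ones that define the ghost series and the higher official series. So
everything reduces to the official series on shelf zero, the Andrews-Bressoud identities.

To prove these, eliminate the ghosts: `officialGF_add_two`, `officialGF_one` and `officialGF_zero`
express shelf `J` through shelf `J + 1`. The alternating sums `altSum` satisfy the same recursion
(`altSum_add_two`, `altSum_one`), up to the factor `(q)_∞ (1 + q) ⋯ (1 + q^J)`. On shelf `J` the
generating functions are `1 + O(q^{J+1})`, and the alternating sums agree with the corresponding
value modulo `q^{J+1}`. A solution of the recursion that is `O(q^{J+1})` on shelf `J` is zero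
(`eq_zero_of_recursion`), because the recursion lifts divisibility from shelf `J + 1` to shelf `J`.
Hence the scaled generating functions are the alternating sums (`scaledOfficialGF_eq_altSum`). On
shelf zero these are the numerators of the products, by the triple product identity
(`numProd_eq_altSum`), a limit of a finite identity with Gaussian binomial coefficients
(`prod_mul_prod_eq_sum_gaussBinom`).
-/

namespace GhostSeries

open PowerSeries
open scoped PowerSeries.WithPiTopology

/-! ### Generating functions of families of multisets -/

/-- The generating function, by the sum of the elements, of the multisets with property `P`. The
cardinality is `Set.ncard`, so this is meaningful only if finitely many of them have a given sum, as
is the case when `P` forces all elements to be positive. -/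
noncomputable def genFun (P : Multiset ℕ → Prop) : PowerSeries ℂ :=
  PowerSeries.mk fun n => (Set.ncard {s : Multiset ℕ | s.sum = n ∧ P s} : ℂ)

theorem finite_sum_eq_of_pos (P : Multiset ℕ → Prop) (hP : ∀ s, P s → ∀ p ∈ s, 0 < p) (n : ℕ) :
    {s : Multiset ℕ | s.sum = n ∧ P s}.Finite := by
  refine (Set.finite_range (fun π : n.Partition => π.parts)).subset ?_
  rintro s ⟨hs, h⟩
  exact ⟨⟨s, fun {i} hi => hP s h i hi, hs⟩, rfl⟩

theorem genFun_eq_add {P A B : Multiset ℕ → Prop} (hP : ∀ s, P s → ∀ p ∈ s, 0 < p)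
    (h : ∀ s, P s ↔ A s ∨ B s) (hAB : ∀ s, A s → ¬ B s) : genFun P = genFun A + genFun B := by
  ext n
  simp only [genFun, coeff_mk, map_add]
  have e : {s : Multiset ℕ | s.sum = n ∧ P s} =
      {s : Multiset ℕ | s.sum = n ∧ A s} ∪ {s : Multiset ℕ | s.sum = n ∧ B s} := by
    ext s
    simp only [Set.mem_ofPred_eq, Set.mem_union, h s, and_or_left]
  rw [e, Set.ncard_union_eq (Set.disjoint_left.2 fun s hs hs' => hAB s hs.2 hs'.2)
    (finite_sum_eq_of_pos A (fun s hs => hP s ((h s).2 (Or.inl hs))) n)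
    (finite_sum_eq_of_pos B (fun s hs => hP s ((h s).2 (Or.inr hs))) n), Nat.cast_add]

/-- Adjoining `m` copies of `a` to every multiset of a family multiplies the generating function by
`X ^ (a * m)`. -/
theorem genFun_replicate_add {P Q : Multiset ℕ → Prop} (a m : ℕ)
    (h : ∀ s, P s ↔ ∃ t, Q t ∧ s = Multiset.replicate m a + t) :
    genFun P = X ^ (a * m) * genFun Q := by
  ext n
  rw [coeff_X_pow_mul']
  simp only [genFun, coeff_mk]
  have hsum : ∀ t : Multiset ℕ, (Multiset.replicate m a + t).sum = a * m + t.sum := by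
    intro t
    rw [Multiset.sum_add, Multiset.sum_replicate, smul_eq_mul, mul_comm]
  split_ifs with hn
  · rw [← Set.ncard_image_of_injective {s : Multiset ℕ | s.sum = n - a * m ∧ Q s}
      (add_right_injective (Multiset.replicate m a))]
    congr 2
    ext s
    simp only [Set.mem_ofPred_eq, Set.mem_image, h s]
    constructor
    · rintro ⟨hs, t, ht, rfl⟩
      rw [hsum] at hs
      exact ⟨t, ⟨by omega, ht⟩, rfl⟩
    · rintro ⟨t, ⟨hs, ht⟩, rfl⟩
      exact ⟨by rw [hsum]; omega, t, ht, rfl⟩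
  · have e : {s : Multiset ℕ | s.sum = n ∧ P s} = ∅ := by
      ext s
      simp only [Set.mem_ofPred_eq, h s, Set.mem_empty_iff_false, iff_false]
      rintro ⟨hs, t, -, rfl⟩
      rw [hsum] at hs
      omega
    simp [e]

/-! ### Shelf families described by multiplicities -/

/-- The conditions on a partition that do not depend on the position on the shelf, in terms of the
multiplicities `f_p` of the parts: all parts are at least `J + 1`, `f_p + f_{p+1} ≤ k - 1`, and
`p f_p + (p + 1) f_{p+1} ≡ c (mod 2)` in case of equality. -/
def MultCond (k J c : ℕ) (s : Multiset ℕ) : Prop :=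
  (∀ p ∈ s, J + 1 ≤ p) ∧
    ∀ p, J + 1 ≤ p → s.count p + s.count (p + 1) + 1 ≤ k ∧
      (s.count p + s.count (p + 1) + 1 = k →
        p * s.count p + (p + 1) * s.count (p + 1) ≡ c [MOD 2])

/-- The generating function of the partitions with parity residue `c` on shelf `J` in which the part
`J + 1` occurs at most `m` times. -/
noncomputable def shelfGF (k J c m : ℕ) : PowerSeries ℂ :=
  genFun fun s => MultCond k J c s ∧ s.count (J + 1) ≤ m

/-- The generating function of the partitions with parity residue `c` on shelf `J` in which the part
`J + 1` occurs exactly `m` times. -/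
noncomputable def shelfExactGF (k J c m : ℕ) : PowerSeries ℂ :=
  genFun fun s => MultCond k J c s ∧ s.count (J + 1) = m

theorem MultCond.pos {k J c : ℕ} {s : Multiset ℕ} (h : MultCond k J c s) : ∀ p ∈ s, 0 < p :=
  fun p hp => lt_of_lt_of_le (Nat.succ_pos J) (h.1 p hp)

theorem shelfGF_congr (k J m : ℕ) {c c' : ℕ} (h : c ≡ c' [MOD 2]) :
    shelfGF k J c m = shelfGF k J c' m := by
  have : ∀ a, a ≡ c [MOD 2] ↔ a ≡ c' [MOD 2] := fun a =>
    ⟨fun ha => ha.trans h, fun ha => ha.trans h.symm⟩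
  simp only [shelfGF, MultCond, this]

theorem shelfGF_zero (k J c : ℕ) : shelfGF k J c 0 = shelfExactGF k J c 0 := by
  simp only [shelfGF, shelfExactGF, Nat.le_zero]

theorem shelfGF_succ (k J c m : ℕ) :
    shelfGF k J c (m + 1) = shelfGF k J c m + shelfExactGF k J c (m + 1) := by
  refine genFun_eq_add (fun s hs => hs.1.pos) (fun s => ?_) (fun s h1 h2 => ?_)
  · rw [← and_or_left, Nat.le_succ_iff]
  · have := h1.2
    have := h2.2
    omega

theorem multCond_replicate_add_iff {k J c m : ℕ} {t : Multiset ℕ} (ht : ∀ p ∈ t, J + 2 ≤ p) :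
    MultCond k J c (Multiset.replicate m (J + 1) + t) ↔
      MultCond k (J + 1) c t ∧ m + t.count (J + 2) + 1 ≤ k ∧
        (m + t.count (J + 2) + 1 = k → (J + 1) * m + (J + 2) * t.count (J + 2) ≡ c [MOD 2]) := by
  have h0 : t.count (J + 1) = 0 := Multiset.count_eq_zero.2 fun h => by
    have := ht _ h
    omega
  have hc : ∀ p, J + 2 ≤ p → (Multiset.replicate m (J + 1) + t).count p = t.count p := by
    intro p hp
    rw [Multiset.count_add, Multiset.count_replicate, if_neg (by omega), zero_add]
  have h1 : (Multiset.replicate m (J + 1) + t).count (J + 1) = m := by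
    rw [Multiset.count_add, Multiset.count_replicate_self, h0, add_zero]
  constructor
  · rintro ⟨-, h⟩
    refine ⟨⟨ht, fun p hp => ?_⟩, ?_⟩
    · have := h p (by omega)
      rwa [hc p hp, hc (p + 1) (by omega)] at this
    · have := h (J + 1) le_rfl
      rwa [h1, hc (J + 1 + 1) le_rfl] at this
  · rintro ⟨⟨-, h⟩, h'⟩
    refine ⟨fun p hp => ?_, fun p hp => ?_⟩
    · rcases Multiset.mem_add.1 hp with hp | hp
      · exact (Multiset.eq_of_mem_replicate hp).ge
      · have := ht p hp
        omega
    · rcases hp.eq_or_lt with rfl | hp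
      · rw [h1, hc (J + 1 + 1) le_rfl]
        exact h'
      · rw [hc p hp, hc (p + 1) (by omega)]
        exact h p hp

/-- Removing the `m` copies of the smallest part `J + 1` leads to the next shelf; the conditions that
involve the removed parts become the bound `m'` on the multiplicity of `J + 2`. -/
theorem shelfExactGF_eq_of_iff {k J c m m' : ℕ}
    (h : ∀ f, (m + f + 1 ≤ k ∧ (m + f + 1 = k → (J + 1) * m + (J + 2) * f ≡ c [MOD 2])) ↔
      f ≤ m') :
    shelfExactGF k J c m = X ^ ((J + 1) * m) * shelfGF k (J + 1) c m' := by
  refine genFun_replicate_add (J + 1) m fun s => ?_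
  constructor
  · rintro ⟨hs, hm⟩
    have e : s = Multiset.replicate m (J + 1) + s.filter (fun p => ¬ p = J + 1) := by
      conv_lhs => rw [← Multiset.filter_add_not (fun p => p = J + 1) s]
      rw [Multiset.filter_eq', hm]
    have ht : ∀ p ∈ s.filter (fun p => ¬ p = J + 1), J + 2 ≤ p := by
      intro p hp
      rw [Multiset.mem_filter] at hp
      have := hs.1 p hp.1
      omega
    refine ⟨_, ?_, e⟩
    rw [e, multCond_replicate_add_iff ht, h] at hs
    exact hs
  · rintro ⟨t, ⟨ht, htm⟩, rfl⟩
    refine ⟨(multCond_replicate_add_iff ht.1).2 ⟨ht, (h _).2 htm⟩, ?_⟩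
    have h0 : t.count (J + 1) = 0 := Multiset.count_eq_zero.2 fun h => by
      have := ht.1 _ h
      omega
    rw [Multiset.count_add, Multiset.count_replicate_self, h0, add_zero]

theorem parity_window {k J m f : ℕ} (h : m + f + 1 = k) :
    (J + 1) * m + (J + 2) * f ≡ J * (k - 1) + m [MOD 2] := by
  subst h
  have e : (J + 1) * m + (J + 2) * f = (J * (m + f + 1 - 1) + m) + 2 * f := by
    rw [Nat.add_sub_cancel]; ring
  rw [e]
  simp [Nat.ModEq]

/-- If `m` copies of `J + 1` together with `k - 1 - m` copies of `J + 2` have a sum of the required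
parity, then the multiplicity of `J + 2` may take all values up to `k - 1 - m`. -/
theorem shelfExactGF_eq {k J c m : ℕ} (hm : m + 1 ≤ k) (hc : J * (k - 1) + m ≡ c [MOD 2]) :
    shelfExactGF k J c m = X ^ ((J + 1) * m) * shelfGF k (J + 1) c (k - 1 - m) := by
  refine shelfExactGF_eq_of_iff fun f => ⟨fun h => by omega, fun h => ⟨by omega, fun h' => ?_⟩⟩
  exact (parity_window h').trans hc

/-- If the parity is the wrong one, then the value `k - 1 - m` is excluded. -/
theorem shelfExactGF_eq' {k J c m : ℕ} (hm : m + 2 ≤ k) (hc : J * (k - 1) + m + 1 ≡ c [MOD 2]) :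
    shelfExactGF k J c m = X ^ ((J + 1) * m) * shelfGF k (J + 1) c (k - 2 - m) := by
  refine shelfExactGF_eq_of_iff fun f => ⟨fun h => ?_, fun h => ⟨by omega, fun h' => by omega⟩⟩
  by_contra hf
  have e : m + f + 1 = k := by omega
  have h1 := (parity_window (J := J) e).symm.trans (h.2 e)
  rw [Nat.ModEq] at h1 hc
  omega

/-! ### Official and ghost generating functions -/

/-- The generating function that the official series at position `k - m` of shelf `J` turns out to
be. -/
noncomputable def officialGF (k J m : ℕ) : PowerSeries ℂ := shelfGF k J (J * (k - 1) + m) m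

/-- The generating function that the ghost series at position `k - m` of shelf `J` turns out to be:
the parity condition is the opposite one. -/
noncomputable def ghostGF (k J m : ℕ) : PowerSeries ℂ := shelfGF k J (J * (k - 1) + m + 1) m

theorem shelfGF_eq_officialGF {k J c m : ℕ} (h : c ≡ J * (k - 1) + m [MOD 2]) :
    shelfGF k J c m = officialGF k J m :=
  shelfGF_congr k J m h

theorem shelfGF_next {k J m : ℕ} (hm : m + 1 ≤ k) :
    shelfGF k (J + 1) (J * (k - 1) + m) (k - 1 - m) = officialGF k (J + 1) (k - 1 - m) := by
  refine shelfGF_congr _ _ _ ?_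
  have e : (J + 1) * (k - 1) + (k - 1 - m) = J * (k - 1) + (k - 1) + (k - 1 - m) := by ring
  rw [e, Nat.ModEq]
  generalize J * (k - 1) = a
  omega

theorem officialGF_zero {k : ℕ} (hk : 1 ≤ k) (J : ℕ) :
    officialGF k J 0 = officialGF k (J + 1) (k - 1) := by
  rw [← Nat.sub_zero (k - 1), ← shelfGF_next (by omega), officialGF, shelfGF_zero,
    shelfExactGF_eq (by omega) rfl]
  simp

theorem officialGF_succ {k J m : ℕ} (hm : m + 2 ≤ k) :
    officialGF k J (m + 1) =
      ghostGF k J m + X ^ ((J + 1) * (m + 1)) * officialGF k (J + 1) (k - 2 - m) := by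
  have e : k - 2 - m = k - 1 - (m + 1) := by omega
  rw [e, ← shelfGF_next (by omega), ← shelfExactGF_eq (by omega) rfl]
  exact shelfGF_succ _ _ _ _

theorem ghostGF_zero {k J : ℕ} (hk : 2 ≤ k) :
    ghostGF k J 0 = officialGF k (J + 1) (k - 2) := by
  have e : k - 2 = k - 1 - (0 + 1) := by omega
  rw [e, ← shelfGF_next (by omega), ghostGF, shelfGF_zero, shelfExactGF_eq' hk rfl, ← e]
  simp

theorem ghostGF_succ {k J m : ℕ} (hm : m + 3 ≤ k) :
    ghostGF k J (m + 1) =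
      officialGF k J m + X ^ ((J + 1) * (m + 1)) * officialGF k (J + 1) (k - 3 - m) := by
  have e : k - 3 - m = k - 1 - (m + 1 + 1) := by omega
  have e' : k - 1 - (m + 1 + 1) = k - 2 - (m + 1) := by omega
  rw [e, ← shelfGF_next (by omega), ghostGF, shelfGF_succ]
  congr 1
  · refine shelfGF_eq_officialGF ?_
    rw [Nat.ModEq]; omega
  · rw [shelfExactGF_eq' (by omega) rfl, e']
    rfl

theorem ghostGF_zero_relation {k J : ℕ} (hk : 2 ≤ k) :
    (1 + X ^ (J + 1)) * ghostGF k J 0 = officialGF k J 1 := by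
  rw [officialGF_succ hk, ghostGF_zero hk]
  simp only [Nat.sub_zero, zero_add, mul_one]
  ring

theorem ghostGF_succ_relation {k J m : ℕ} (hm : m + 3 ≤ k) :
    (1 + X ^ (J + 1)) * ghostGF k J (m + 1) =
      officialGF k J (m + 2) + X ^ (J + 1) * officialGF k J m := by
  have e : k - 2 - (m + 1) = k - 3 - m := by omega
  rw [officialGF_succ (m := m + 1) hm, ghostGF_succ hm, e, Nat.mul_succ (J + 1) (m + 1), pow_add]
  ring

/-- The recursion that expresses shelf `J` in terms of shelf `J + 1`. -/
theorem officialGF_add_two {k J m : ℕ} (hm : m + 3 ≤ k) :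
    officialGF k J (m + 2) = officialGF k J m +
      X ^ ((J + 1) * (m + 1)) * ((1 + X ^ (J + 1)) * officialGF k (J + 1) (k - 3 - m)) := by
  have e : k - 2 - (m + 1) = k - 3 - m := by omega
  rw [officialGF_succ (m := m + 1) hm, ghostGF_succ hm, e, Nat.mul_succ (J + 1) (m + 1), pow_add]
  ring

theorem officialGF_one {k J : ℕ} (hk : 2 ≤ k) :
    officialGF k J 1 = (1 + X ^ (J + 1)) * officialGF k (J + 1) (k - 2) := by
  rw [← ghostGF_zero_relation hk, ghostGF_zero hk]

/-- Apart from the empty partition, shelf `J` has only partitions of integers greater than `J`. -/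
theorem X_pow_dvd_officialGF_sub_one {k : ℕ} (hk : 2 ≤ k) (J m : ℕ) :
    (X : PowerSeries ℂ) ^ (J + 1) ∣ officialGF k J m - 1 := by
  rw [X_pow_dvd_iff]
  intro n hn
  rw [map_sub, coeff_one, officialGF, shelfGF, genFun, coeff_mk]
  split_ifs with h0
  · subst h0
    have e : {s : Multiset ℕ | s.sum = 0 ∧ MultCond k J (J * (k - 1) + m) s ∧
        s.count (J + 1) ≤ m} = {0} := by
      ext s
      simp only [Set.mem_ofPred_eq, Set.mem_singleton_iff]
      constructor
      · rintro ⟨hs, h, -⟩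
        refine Multiset.eq_zero_of_forall_notMem fun p hp => ?_
        have := Multiset.le_sum_of_mem hp
        have := h.pos p hp
        omega
      · rintro rfl
        refine ⟨by simp, ⟨by simp, fun p _ => ⟨?_, ?_⟩⟩, by simp⟩
        · simp; omega
        · simp; omega
    simp [e]
  · have e : {s : Multiset ℕ | s.sum = n ∧ MultCond k J (J * (k - 1) + m) s ∧
        s.count (J + 1) ≤ m} = ∅ := by
      ext s
      simp only [Set.mem_ofPred_eq, Set.mem_empty_iff_false, iff_false]
      rintro ⟨hs, h, -⟩
      rcases Multiset.empty_or_exists_mem s with rfl | ⟨p, hp⟩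
      · simp at hs; omega
      · have := Multiset.le_sum_of_mem hp
        have := h.1 p hp
        omega
    simp [e]

/-! ### From conditions on consecutive parts to conditions on multiplicities -/

theorem length_filter_eq_count_add_count (L : List ℕ) (p : ℕ) :
    (L.filter fun x => x = p ∨ x = p + 1).length = L.count p + L.count (p + 1) := by
  induction L with
  | nil => simp
  | cons a L ih =>
    simp only [List.filter_cons, List.count_cons, beq_iff_eq, decide_eq_true_eq]
    split_ifs <;> (try simp only [List.length_cons]) <;> omega

theorem sum_filter_eq_mul_count_add (L : List ℕ) (p : ℕ) :
    (L.filter fun x => x = p ∨ x = p + 1).sum = p * L.count p + (p + 1) * L.count (p + 1) := by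
  induction L with
  | nil => simp
  | cons a L ih =>
    rcases eq_or_ne a p with rfl | h1
    · rw [List.filter_cons_of_pos (by simp), List.sum_cons, ih, List.count_cons_self,
        List.count_cons_of_ne (by omega)]
      ring
    · rcases eq_or_ne a (p + 1) with rfl | h2
      · rw [List.filter_cons_of_pos (by simp), List.sum_cons, ih, List.count_cons_self,
          List.count_cons_of_ne (by omega)]
        ring
      · rw [List.filter_cons_of_neg (by simp [h1, h2]), ih, List.count_cons_of_ne h1,
          List.count_cons_of_ne h2]

theorem eq_filter_append_filter_of_pairwise {L : List ℕ} (hL : L.Pairwise (· ≥ ·)) (a : ℕ) :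
    L = L.filter (fun x => a ≤ x) ++ L.filter (fun x => ¬ a ≤ x) := by
  induction L with
  | nil => rfl
  | cons b L ih =>
    have hL' := List.pairwise_cons.1 hL
    by_cases hb : a ≤ b
    · rw [List.filter_cons_of_pos (by simpa using hb), List.filter_cons_of_neg (by simpa using hb),
        List.cons_append, ← ih hL'.2]
    · have h : ∀ x ∈ b :: L, x < a := by
        intro x hx
        rcases List.mem_cons.1 hx with rfl | hx
        · omega
        · have := hL'.1 x hx
          omega
      rw [List.filter_eq_nil_iff.2 (fun x hx => by simpa using h x hx),
        List.filter_eq_self.2 (fun x hx => by simpa using h x hx), List.nil_append]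

/-- In a nonincreasing list, the elements equal to `p` or `p + 1` are consecutive. -/
theorem exists_eq_append_filter_append {L : List ℕ} (hL : L.Pairwise (· ≥ ·)) (p : ℕ) :
    ∃ A B, L = A ++ ((L.filter fun x => x = p ∨ x = p + 1) ++ B) := by
  refine ⟨L.filter (fun x => p + 2 ≤ x),
    (L.filter (fun x => ¬ p + 2 ≤ x)).filter (fun x => ¬ p ≤ x), ?_⟩
  have e : (L.filter fun x => x = p ∨ x = p + 1) =
      (L.filter (fun x => ¬ p + 2 ≤ x)).filter (fun x => p ≤ x) := by
    rw [List.filter_filter]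
    refine List.filter_congr fun x _ => ?_
    rw [← Bool.decide_and, decide_eq_decide]
    omega
  rw [e, ← eq_filter_append_filter_of_pairwise (hL.filter _) p]
  exact eq_filter_append_filter_of_pairwise hL (p + 2)

theorem sum_take_drop (L : List ℕ) (t w : ℕ) (h : t + w ≤ L.length) :
    ((L.drop t).take w).sum = ∑ s ∈ Finset.range w, L.getD (t + s) 0 := by
  induction w with
  | zero => simp
  | succ w ih =>
    rw [Finset.sum_range_succ, ← ih (by omega),
      List.sum_take_succ _ _ (by rw [List.length_drop]; omega), List.getElem_drop,
      List.getD_eq_getElem _ _ (by omega)]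

theorem getD_le_getD_of_pairwise {L : List ℕ} (hL : L.Pairwise (· ≥ ·)) {a b : ℕ} (hab : a ≤ b)
    (hb : b < L.length) : L.getD b 0 ≤ L.getD a 0 := by
  rw [List.getD_eq_getElem _ _ hb, List.getD_eq_getElem _ _ (by omega)]
  rcases hab.eq_or_lt with rfl | hab
  · exact le_rfl
  · exact List.pairwise_iff_getElem.1 hL a b (by omega) hb hab

/-- A window of `w + 1` consecutive elements of a nonincreasing list whose first and last elements
differ by at most one is part of the block of all elements equal to `p` or `p + 1`, where `p` is the
last element of the window. -/
theorem window_sublist {L : List ℕ} (hL : L.Pairwise (· ≥ ·)) {t w : ℕ} (h : t + w < L.length)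
    (hd : L.getD t 0 ≤ L.getD (t + w) 0 + 1) :
    ((L.drop t).take (w + 1)).Sublist
      (L.filter fun x => x = L.getD (t + w) 0 ∨ x = L.getD (t + w) 0 + 1) := by
  set p := L.getD (t + w) 0 with hp
  have hall : ∀ x ∈ (L.drop t).take (w + 1), x = p ∨ x = p + 1 := by
    intro x hx
    obtain ⟨s, hs, rfl⟩ := List.mem_iff_getElem.1 hx
    rw [List.length_take, List.length_drop] at hs
    rw [List.getElem_take, List.getElem_drop, ← List.getD_eq_getElem L 0 (by omega)]
    have h1 := getD_le_getD_of_pairwise hL (a := t + s) (b := t + w) (by omega) h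
    have h2 := getD_le_getD_of_pairwise hL (a := t) (b := t + s) (by omega) (by omega)
    omega
  have := ((List.take_sublist (w + 1) (L.drop t)).trans (List.drop_sublist t L)).filter
    (fun x => x = p ∨ x = p + 1)
  rwa [List.filter_eq_self.2 (fun x hx => by simpa using hall x hx)] at this

/-- For a nonincreasing list, the conditions on windows of `k` and of `k - 1` consecutive elements
amount to conditions on multiplicities. -/
theorem window_conditions_iff {k : ℕ} (hk : 2 ≤ k) (J c : ℕ) {L : List ℕ}
    (hL : L.Pairwise (· ≥ ·)) (hJ : ∀ p ∈ L, J + 1 ≤ p) :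
    ((∀ t, t + (k - 1) < L.length → L.getD (t + (k - 1)) 0 + 2 ≤ L.getD t 0) ∧
      ∀ t, t + (k - 2) < L.length → L.getD t 0 ≤ L.getD (t + (k - 2)) 0 + 1 →
        (∑ s ∈ Finset.range (k - 1), L.getD (t + s) 0) ≡ c [MOD 2]) ↔
    ∀ p, J + 1 ≤ p → L.count p + L.count (p + 1) + 1 ≤ k ∧
      (L.count p + L.count (p + 1) + 1 = k →
        p * L.count p + (p + 1) * L.count (p + 1) ≡ c [MOD 2]) := by
  have mem : ∀ t, t < L.length → J + 1 ≤ L.getD t 0 := fun t ht => by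
    rw [List.getD_eq_getElem _ _ ht]
    exact hJ _ (List.getElem_mem ht)
  constructor
  · rintro ⟨hdiff, hpar⟩ p -
    obtain ⟨A, B, hAB⟩ := exists_eq_append_filter_append hL p
    rw [← length_filter_eq_count_add_count, ← sum_filter_eq_mul_count_add]
    have hM : ∀ x ∈ L.filter (fun x => x = p ∨ x = p + 1), x = p ∨ x = p + 1 := fun x hx => by
      simpa using (List.mem_filter.1 hx).2
    generalize L.filter (fun x => x = p ∨ x = p + 1) = M at hAB hM
    have hlen : L.length = A.length + (M.length + B.length) := by
      rw [hAB, List.length_append, List.length_append]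
    have hblock : ∀ s, s < M.length → L.getD (A.length + s) 0 = p ∨
        L.getD (A.length + s) 0 = p + 1 := by
      intro s hs
      refine hM _ ?_
      rw [hAB, List.getD_append_right _ _ _ _ (by omega), Nat.add_sub_cancel_left,
        List.getD_append _ _ _ _ hs, List.getD_eq_getElem _ _ hs]
      exact List.getElem_mem hs
    refine ⟨?_, fun hlast => ?_⟩
    · by_contra hlong
      have h1 := hdiff A.length (by omega)
      have h2 := hblock 0 (by omega)
      have h3 := hblock (k - 1) (by omega)
      rw [Nat.add_zero] at h2
      omega
    · have h2 := hblock 0 (by omega)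
      have h3 := hblock (k - 2) (by omega)
      rw [Nat.add_zero] at h2
      have h4 := hpar A.length (by omega) (by omega)
      rw [← sum_take_drop _ _ _ (by omega)] at h4
      have e : (L.drop A.length).take (k - 1) = M := by
        rw [hAB, List.drop_left, List.take_left' (by omega)]
      rwa [e] at h4
  · intro h
    refine ⟨fun t ht => ?_, fun t ht hd => ?_⟩
    · by_contra hd
      have h1 := (window_sublist hL ht (by omega)).length_le
      have h2 := (h _ (mem _ ht)).1
      rw [length_filter_eq_count_add_count, List.length_take, List.length_drop] at h1
      omega
    · have h1 := window_sublist hL ht hd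
      have h2 := h _ (mem _ ht)
      rw [← length_filter_eq_count_add_count, ← sum_filter_eq_mul_count_add] at h2
      have e : k - 2 + 1 = k - 1 := by omega
      rw [e] at h1
      have hl : ((L.drop t).take (k - 1)).length = k - 1 := by
        rw [List.length_take, List.length_drop]; omega
      have h3 := h1.length_le
      rw [← sum_take_drop _ _ _ (by omega), h1.eq_of_length (by omega)]
      exact h2.2 (by omega)

theorem admissible_iff {k : ℕ} (hk : 2 ≤ k) (J i c : ℕ) {n : ℕ} (π : n.Partition) :
    Admissible k J i c π ↔ MultCond k J c π.parts ∧ π.parts.count (J + 1) ≤ k - i := by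
  have hsort : (↑(sortedParts π) : Multiset ℕ) = π.parts := Multiset.sort_eq _ _
  have hlen : π.parts.card = (sortedParts π).length := by rw [← hsort, Multiset.coe_card]
  have hcount : ∀ p, π.parts.count p = (sortedParts π).count p := fun p => by
    rw [← hsort, Multiset.coe_count]
  have hmem : ∀ p, p ∈ π.parts ↔ p ∈ sortedParts π := fun p => by rw [← hsort, Multiset.mem_coe]
  have hL : (sortedParts π).Pairwise (· ≥ ·) := Multiset.pairwise_sort _ _
  constructor
  · intro h
    have hJ : ∀ p ∈ sortedParts π, J + 1 ≤ p := fun p hp => h.smallest p ((hmem p).2 hp)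
    refine ⟨⟨h.smallest, ?_⟩, h.multiplicity⟩
    simp only [hcount]
    exact (window_conditions_iff hk J c hL hJ).1
      ⟨fun t ht => h.difference t (hlen ▸ ht), fun t ht => h.parity t (hlen ▸ ht)⟩
  · rintro ⟨⟨hJ, h⟩, hm⟩
    simp only [hcount] at h
    have := (window_conditions_iff hk J c hL fun p hp => hJ p ((hmem p).2 hp)).2 h
    exact ⟨fun t ht => this.1 t (hlen ▸ ht), hJ, hm, fun t ht => this.2 t (hlen ▸ ht)⟩

theorem mk_ghostCount {k : ℕ} (hk : 2 ≤ k) (J : ℕ) {i : ℕ} (hik : i ≤ k) :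
    (PowerSeries.mk fun n => (ghostCount k J i n : ℂ)) = ghostGF k J (k - i) := by
  have hc : (k - 1) * J + i + k + 1 ≡ J * (k - 1) + (k - i) + 1 [MOD 2] := by
    rw [mul_comm, Nat.ModEq]
    omega
  rw [ghostGF, ← shelfGF_congr _ _ _ hc, shelfGF, genFun]
  ext n
  simp only [coeff_mk, ghostCount, ← Nat.card_coe_set_eq]
  congr 1
  refine Nat.card_congr ⟨fun π => ⟨π.1.parts, π.1.parts_sum, (admissible_iff hk _ _ _ _).1 π.2⟩,
    fun s => ⟨⟨s.1, fun {p} hp => s.2.2.1.pos p hp, s.2.1⟩, (admissible_iff hk _ _ _ _).2 s.2.2⟩,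
    fun _ => rfl, fun _ => rfl⟩

/-! ### Infinite sums and products of power series modulo powers of `X` -/

theorem summable_of_X_pow_dvd {f : ℕ → PowerSeries ℂ} (h : ∀ n, X ^ n ∣ f n) : Summable f := by
  refine WithPiTopology.summable_of_tendsto_order_atTop_nhds_top _ ?_
  refine ENat.tendsto_nhds_top_iff_natCast_lt.mpr fun n => Filter.eventually_atTop.mpr
    ⟨n + 1, fun m hm => ?_⟩
  refine lt_of_lt_of_le (b := ((n + 1 : ℕ) : ℕ∞)) (by exact_mod_cast Nat.lt_succ_self n) ?_
  exact le_order _ _ fun i hi => X_pow_dvd_iff.1 (h m) i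
    (lt_of_lt_of_le (by exact_mod_cast hi) hm)

/-- A power series to which a sequence converges is congruent to all members of the sequence from
the point on from which these are congruent to each other. -/
theorem X_pow_dvd_sub_of_tendsto {g : ℕ → PowerSeries ℂ} {F : PowerSeries ℂ}
    (hg : Filter.Tendsto g Filter.atTop (nhds F)) {M N : ℕ}
    (h : ∀ n, N ≤ n → X ^ M ∣ g (n + 1) - g n) : X ^ M ∣ F - g N := by
  have hconst : ∀ n, N ≤ n → X ^ M ∣ g n - g N := by
    intro n hn
    induction n, hn using Nat.le_induction with
    | base => simp
    | succ n hn ih => simpa using dvd_add (h n hn) ih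
  rw [X_pow_dvd_iff]
  intro d hd
  have h1 := ((WithPiTopology.continuous_coeff ℂ d).tendsto F).comp hg
  have h2 : Filter.Tendsto (fun n => coeff d (g n)) Filter.atTop (nhds (coeff d (g N))) := by
    refine tendsto_const_nhds.congr' (Filter.eventually_atTop.2 ⟨N, fun n hn => ?_⟩)
    have := X_pow_dvd_iff.1 (hconst n hn) d hd
    rw [map_sub, sub_eq_zero] at this
    exact this.symm
  rw [map_sub, sub_eq_zero]
  exact tendsto_nhds_unique h1 h2

theorem X_pow_dvd_tsum_sub {f : ℕ → PowerSeries ℂ} (hf : Summable f) {M N : ℕ}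
    (h : ∀ n, N ≤ n → X ^ M ∣ f n) : X ^ M ∣ ∑' n, f n - ∑ n ∈ Finset.range N, f n := by
  refine X_pow_dvd_sub_of_tendsto hf.hasSum.tendsto_sum_nat fun n hn => ?_
  rw [Finset.sum_range_succ, add_sub_cancel_left]
  exact h n hn

theorem X_pow_dvd_tprod_sub {f : ℕ → PowerSeries ℂ} (hf : Multipliable f) {M N : ℕ}
    (h : ∀ n, N ≤ n → X ^ M ∣ f n - 1) : X ^ M ∣ ∏' n, f n - ∏ n ∈ Finset.range N, f n := by
  refine X_pow_dvd_sub_of_tendsto hf.hasProd.tendsto_prod_nat fun n hn => ?_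
  rw [Finset.prod_range_succ, ← mul_sub_one]
  exact dvd_mul_of_dvd_right (h n hn) _

theorem eq_of_forall_X_pow_dvd_sub {F G : PowerSeries ℂ} (h : ∀ N : ℕ, X ^ N ∣ F - G) : F = G := by
  ext d
  have := X_pow_dvd_iff.1 (h (d + 1)) d (Nat.lt_succ_self d)
  rwa [map_sub, sub_eq_zero] at this

/-! ### The alternating sums on the shelves -/

/-- The `n`-th term of the alternating sum on shelf `J`; the position on the shelf is `d + 1`, and
`d + u = k`. -/
noncomputable def altTerm (k J d u n : ℕ) : PowerSeries ℂ :=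
  (-1) ^ n * X ^ (k * n ^ 2 + (J * (k - 1) + d) * n) * (1 - X ^ (u * (2 * n + J + 1))) *
    ∏ s ∈ Finset.range J, (1 - X ^ (2 * (n + s + 1)))

/-- The alternating sum
`∑ (-1)^n q^{k n² + (J (k - 1) + k - u) n} (1 - q^{u (2 n + J + 1)}) ∏_{s = 1}^{J} (1 - q^{2 (n + s)})`
over `n ≥ 0`. -/
noncomputable def altSum (k J u : ℕ) : PowerSeries ℂ := ∑' n, altTerm k J (k - u) u n

theorem X_pow_dvd_altTerm {k : ℕ} (hk : 1 ≤ k) (J d u n : ℕ) :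
    X ^ (n ^ 2 + J * (k - 1) * n) ∣ altTerm k J d u n := by
  unfold altTerm
  refine dvd_mul_of_dvd_left (dvd_mul_of_dvd_left (dvd_mul_of_dvd_right (pow_dvd_pow X ?_) _) _) _
  have h1 : 1 * n ^ 2 ≤ k * n ^ 2 := Nat.mul_le_mul_right _ hk
  have h2 : J * (k - 1) * n ≤ (J * (k - 1) + d) * n := Nat.mul_le_mul_right _ (Nat.le_add_right _ _)
  omega

theorem summable_altTerm {k : ℕ} (hk : 1 ≤ k) (J d u : ℕ) : Summable (altTerm k J d u) := by
  refine summable_of_X_pow_dvd fun n => (pow_dvd_pow X ?_).trans (X_pow_dvd_altTerm hk J d u n)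
  have : n ≤ n ^ 2 := Nat.le_self_pow two_ne_zero n
  omega

theorem altSum_zero (k J : ℕ) : altSum k J 0 = 0 := by
  simp [altSum, altTerm]

theorem prod_range_shift (J n : ℕ) :
    (1 - X ^ (2 * (n + 1))) * ∏ s ∈ Finset.range J, (1 - X ^ (2 * (n + 1 + s + 1)) : PowerSeries ℂ) =
      ∏ s ∈ Finset.range (J + 1), (1 - X ^ (2 * (n + s + 1))) := by
  rw [Finset.prod_range_succ', mul_comm]
  congr 1
  refine Finset.prod_congr rfl fun s _ => ?_
  rw [show n + 1 + s + 1 = n + (s + 1) + 1 by ring]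

/-- Summation by parts: the part of a summand on shelf `J` with the factor `1 - X ^ (2 * n)` vanishes
at `n = 0`, and shifted by one index it has the products of the next shelf. -/
theorem tsum_eq_tsum_shift {a b c : ℕ → PowerSeries ℂ} (ha : Summable a) (hb : Summable b)
    (h0 : a 0 = 0) (h : ∀ n, a (n + 1) + b n = c n) :
    ∑' n, (a n + b n) = ∑' n, c n := by
  rw [ha.tsum_add hb, ha.tsum_eq_zero_add, h0, zero_add,
    ← ((summable_nat_add_iff 1).2 ha).tsum_add hb]
  exact tsum_congr h

theorem altSum_add_two {k u : ℕ} (hu : u + 2 ≤ k) (J : ℕ) :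
    altSum k J (u + 2) =
      altSum k J u + X ^ ((J + 1) * u) * altSum k (J + 1) (k - 1 - u) := by
  obtain ⟨d, rfl⟩ := Nat.exists_eq_add_of_le hu
  have hk : 1 ≤ u + 2 + d := by omega
  rw [← sub_eq_iff_eq_add', altSum, altSum, altSum,
    show u + 2 + d - (u + 2) = d by omega, show u + 2 + d - u = d + 2 by omega,
    show u + 2 + d - 1 - u = d + 1 by omega, show u + 2 + d - (d + 1) = u + 1 by omega,
    ← (summable_altTerm hk J d (u + 2)).tsum_sub (summable_altTerm hk J (d + 2) u),
    ← (summable_altTerm hk (J + 1) (u + 1) (d + 1)).tsum_mul_left]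
  set e : ℕ → ℕ := fun n => (u + 2 + d) * n ^ 2 + (J * (u + 2 + d - 1) + d) * n with he
  have hen : ∀ n, n ≤ e n := fun n => by
    have h1 : n ≤ n ^ 2 := Nat.le_self_pow two_ne_zero n
    have h2 : 1 * n ^ 2 ≤ (u + 2 + d) * n ^ 2 := Nat.mul_le_mul_right _ hk
    simp only [he]
    omega
  set W : ℕ → ℕ → PowerSeries ℂ := fun J n => ∏ s ∈ Finset.range J, (1 - X ^ (2 * (n + s + 1)))
    with hW
  -- `1 - X ^ ((u + 2) * v) - X ^ (2 * n) * (1 - X ^ (u * v))`, where `v = 2 * n + J + 1`, is the sum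
  -- of `1 - X ^ (2 * n)` and `X ^ (2 * n + u * v) * (1 - X ^ (2 * (n + J + 1)))`.
  refine (tsum_congr fun n => ?_).trans (tsum_eq_tsum_shift
    (a := fun n => X ^ e n * ((-1) ^ n * ((1 - X ^ (2 * n)) * W J n)))
    (b := fun n => X ^ e n * ((-1) ^ n * (X ^ (2 * n + u * (2 * n + J + 1)) * W (J + 1) n)))
    (summable_of_X_pow_dvd fun n => dvd_mul_of_dvd_left (pow_dvd_pow X (hen n)) _)
    (summable_of_X_pow_dvd fun n => dvd_mul_of_dvd_left (pow_dvd_pow X (hen n)) _)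
    (by simp) fun n => ?_)
  · simp only [altTerm, hW, Finset.prod_range_succ]
    rw [show (u + 2 + d) * n ^ 2 + (J * (u + 2 + d - 1) + d) * n = e n from rfl,
      show (u + 2 + d) * n ^ 2 + (J * (u + 2 + d - 1) + (d + 2)) * n = e n + 2 * n by
        simp only [he]; ring,
      show (u + 2) * (2 * n + J + 1) = 2 * n + u * (2 * n + J + 1) + 2 * (n + J + 1) by ring]
    simp only [pow_add]
    ring
  · have h1 : (1 - X ^ (2 * (n + 1))) * W J (n + 1) = W (J + 1) n := prod_range_shift J n
    have h2 : altTerm (u + 2 + d) (J + 1) (u + 1) (d + 1) n =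
      (-1) ^ n * X ^ ((u + 2 + d) * n ^ 2 + ((J + 1) * (u + 2 + d - 1) + (u + 1)) * n) *
        (1 - X ^ ((d + 1) * (2 * n + (J + 1) + 1))) * W (J + 1) n := rfl
    have h3 : e n + (2 * n + u * (2 * n + J + 1)) = (J + 1) * u +
        ((u + 2 + d) * n ^ 2 + ((J + 1) * (u + 2 + d - 1) + (u + 1)) * n) := by
      simp only [he, show u + 2 + d - 1 = u + 1 + d by omega]
      ring
    have h4 : e (n + 1) = (J + 1) * u +
        ((u + 2 + d) * n ^ 2 + ((J + 1) * (u + 2 + d - 1) + (u + 1)) * n) +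
          (d + 1) * (2 * n + (J + 1) + 1) := by
      simp only [he, show u + 2 + d - 1 = u + 1 + d by omega]
      ring
    have h5 : (X : PowerSeries ℂ) ^ e n * X ^ (2 * n + u * (2 * n + J + 1)) = X ^ ((J + 1) * u) *
        X ^ ((u + 2 + d) * n ^ 2 + ((J + 1) * (u + 2 + d - 1) + (u + 1)) * n) := by
      rw [← pow_add, h3, pow_add]
    have h6 : (X : PowerSeries ℂ) ^ e (n + 1) = X ^ ((J + 1) * u) *
        X ^ ((u + 2 + d) * n ^ 2 + ((J + 1) * (u + 2 + d - 1) + (u + 1)) * n) *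
          X ^ ((d + 1) * (2 * n + (J + 1) + 1)) := by
      rw [h4, pow_add, pow_add]
    simp only [h1, h2]
    linear_combination (-1) ^ (n + 1) * W (J + 1) n * h6 + (-1) ^ n * W (J + 1) n * h5

theorem altSum_one {k : ℕ} (hk : 1 ≤ k) (J : ℕ) :
    (1 + X ^ (J + 1)) * altSum k J 1 = altSum k (J + 1) k := by
  rw [altSum, altSum, Nat.sub_self, ← (summable_altTerm hk J (k - 1) 1).tsum_mul_left]
  obtain ⟨d, rfl⟩ := Nat.exists_eq_add_of_le' hk
  rw [Nat.add_sub_cancel]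
  set e : ℕ → ℕ := fun n => (d + 1) * n ^ 2 + (J * d + d) * n with he
  have hen : ∀ n, n ≤ e n := fun n => by
    have h1 : n ≤ n ^ 2 := Nat.le_self_pow two_ne_zero n
    have h2 : 1 * n ^ 2 ≤ (d + 1) * n ^ 2 := Nat.mul_le_mul_right _ hk
    simp only [he]
    omega
  set W : ℕ → ℕ → PowerSeries ℂ := fun J n => ∏ s ∈ Finset.range J, (1 - X ^ (2 * (n + s + 1)))
    with hW
  -- `(1 + X ^ (J + 1)) * (1 - X ^ (2 * n + J + 1))` is the sum of
  -- `X ^ (J + 1) * (1 - X ^ (2 * n))` and `1 - X ^ (2 * (n + J + 1))`.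
  refine (tsum_congr fun n => ?_).trans (tsum_eq_tsum_shift
    (a := fun n => X ^ e n * ((-1) ^ n * X ^ (J + 1) * ((1 - X ^ (2 * n)) * W J n)))
    (b := fun n => X ^ e n * ((-1) ^ n * W (J + 1) n))
    (summable_of_X_pow_dvd fun n => dvd_mul_of_dvd_left (pow_dvd_pow X (hen n)) _)
    (summable_of_X_pow_dvd fun n => dvd_mul_of_dvd_left (pow_dvd_pow X (hen n)) _)
    (by simp) fun n => ?_)
  · simp only [altTerm, hW, Finset.prod_range_succ, Nat.add_sub_cancel]
    rw [show (d + 1) * n ^ 2 + (J * d + d) * n = e n from rfl,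
      show 2 * (n + J + 1) = n + n + (J + J + 1 + 1) by ring,
      show 1 * (2 * n + J + 1) = n + n + J + 1 by ring, show 2 * n = n + n by ring]
    simp only [pow_add]
    ring
  · have h1 : (1 - X ^ (2 * (n + 1))) * W J (n + 1) = W (J + 1) n := prod_range_shift J n
    have h2 : altTerm (d + 1) (J + 1) 0 (d + 1) n =
      (-1) ^ n * X ^ ((d + 1) * n ^ 2 + ((J + 1) * d + 0) * n) *
        (1 - X ^ ((d + 1) * (2 * n + (J + 1) + 1))) * W (J + 1) n := rfl
    have h3 : (d + 1) * n ^ 2 + ((J + 1) * d + 0) * n = e n := by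
      simp only [he]
      ring
    have h4 : e (n + 1) + (J + 1) = e n + (d + 1) * (2 * n + (J + 1) + 1) := by
      simp only [he]
      ring
    simp only [h1, h2, h3]
    have h5 : (X : PowerSeries ℂ) ^ e (n + 1) * X ^ (J + 1) =
        X ^ e n * X ^ ((d + 1) * (2 * n + (J + 1) + 1)) := by
      rw [← pow_add, h4, pow_add]
    linear_combination (-1) ^ (n + 1) * W (J + 1) n * h5

theorem X_pow_dvd_altSum_sub {k u : ℕ} (hk : 2 ≤ k) (hu : 1 ≤ u) (J : ℕ) :
    X ^ (J + 1) ∣ altSum k J u - ∏ s ∈ Finset.range J, (1 - X ^ (2 * (s + 1))) := by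
  have h1 : X ^ (J + 1) ∣ altSum k J u -
      ∑ n ∈ Finset.range 1, altTerm k J (k - u) u n := by
    refine X_pow_dvd_tsum_sub (summable_altTerm (by omega) J (k - u) u) fun n hn => ?_
    refine (pow_dvd_pow X ?_).trans (X_pow_dvd_altTerm (by omega) J (k - u) u n)
    have h2 : n ≤ n ^ 2 := Nat.le_self_pow two_ne_zero n
    have h3 : J * 1 ≤ J * ((k - 1) * n) :=
      Nat.mul_le_mul_left J (Nat.mul_pos (by omega) hn)
    rw [mul_assoc]
    omega
  have h2 : altTerm k J (k - u) u 0 = ∏ s ∈ Finset.range J, (1 - X ^ (2 * (s + 1))) -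
      X ^ (u * (J + 1)) * ∏ s ∈ Finset.range J, (1 - X ^ (2 * (s + 1))) := by
    simp only [altTerm]
    simp
    ring
  rw [Finset.sum_range_one, h2] at h1
  have h3 : (X : PowerSeries ℂ) ^ (J + 1) ∣ X ^ (u * (J + 1)) :=
    pow_dvd_pow X (Nat.le_mul_of_pos_left _ hu)
  have h4 := dvd_sub h1 (dvd_mul_of_dvd_left h3 (∏ s ∈ Finset.range J, (1 - X ^ (2 * (s + 1)))))
  convert h4 using 1
  ring

/-! ### Uniqueness of the solution of the recursion -/

theorem isUnit_one_add_X_pow (J : ℕ) : IsUnit (1 + X ^ (J + 1) : PowerSeries ℂ) := by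
  rw [isUnit_iff_constantCoeff]
  simp

/-- The recursion expresses each shelf through the next one, and so a solution whose members on shelf
`J` are divisible by `X ^ (J + 1)` is divisible by all powers of `X`. -/
theorem eq_zero_of_recursion {k : ℕ} (E : ℕ → ℕ → PowerSeries ℂ) (h0 : ∀ J, E J 0 = 0)
    (h1 : ∀ J, (1 + X ^ (J + 1)) * E J 1 = E (J + 1) k)
    (h2 : ∀ J u, u + 2 ≤ k →
      E J (u + 2) = E J u + X ^ ((J + 1) * u) * E (J + 1) (k - 1 - u))
    (hE : ∀ J u, u ≤ k → X ^ (J + 1) ∣ E J u) {J u : ℕ} (hu : u ≤ k) : E J u = 0 := by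
  have key : ∀ t J u, u ≤ k → X ^ (J + 1 + t) ∣ E J u := by
    intro t
    induction t with
    | zero => exact hE
    | succ t ih =>
      intro J u
      induction u using Nat.strong_induction_on with
      | _ u ihu =>
        intro hu
        match u, ihu, hu with
        | 0, _, _ => rw [h0]; exact dvd_zero _
        | 1, _, _ =>
          rw [← (isUnit_one_add_X_pow J).dvd_mul_left, h1, ← Nat.add_assoc, Nat.add_right_comm]
          exact ih (J + 1) k le_rfl
        | u + 2, ihu, hu =>
          rw [h2 J u hu]
          refine dvd_add (ihu u (by omega) (by omega)) (dvd_mul_of_dvd_right ?_ _)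
          rw [← Nat.add_assoc, Nat.add_right_comm]
          exact ih (J + 1) _ (by omega)
  refine eq_of_forall_X_pow_dvd_sub fun N => ?_
  rw [sub_zero]
  exact (pow_dvd_pow X (by omega)).trans (key N J u hu)

/-- Up to the factor `(q)_∞ (1 + q) ⋯ (1 + q^J)`, the official generating functions, indexed so that
the recursion also holds at the boundary of the shelf. -/
noncomputable def scaledOfficialGF (k J : ℕ) : ℕ → PowerSeries ℂ
  | 0 => 0
  | u + 1 => qInf * (∏ j ∈ Finset.range J, (1 + X ^ (j + 1))) * officialGF k J u

theorem X_pow_dvd_qInf_sub (J : ℕ) :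
    X ^ (J + 1) ∣ qInf - ∏ s ∈ Finset.range J, (1 - X ^ (s + 1) : PowerSeries ℂ) := by
  refine X_pow_dvd_tprod_sub multipliable_qInf fun n hn => ?_
  rw [sub_sub_cancel_left, dvd_neg]
  exact pow_dvd_pow X (by omega)

theorem scaledOfficialGF_eq_altSum {k u : ℕ} (hk : 2 ≤ k) (hu : u ≤ k) (J : ℕ) :
    scaledOfficialGF k J u = altSum k J u := by
  refine sub_eq_zero.1 (eq_zero_of_recursion (k := k)
    (fun J u => scaledOfficialGF k J u - altSum k J u) (fun J => ?_) (fun J => ?_)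
    (fun J u hu => ?_) (fun J u hu => ?_) hu)
  · simp [altSum_zero, scaledOfficialGF]
  · obtain ⟨k, rfl⟩ := Nat.exists_eq_add_of_le' (show 1 ≤ k by omega)
    rw [mul_sub, altSum_one (by omega)]
    simp only [scaledOfficialGF, Finset.prod_range_succ]
    rw [officialGF_zero (by omega), Nat.add_sub_cancel]
    ring
  · rw [altSum_add_two hu]
    have e : k - 1 - u = k - 2 - u + 1 := by omega
    rw [e]
    cases u with
    | zero =>
      simp only [scaledOfficialGF, Finset.prod_range_succ]
      rw [officialGF_one hk, Nat.sub_zero]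
      ring
    | succ u =>
      simp only [scaledOfficialGF, Finset.prod_range_succ]
      rw [officialGF_add_two hu, show k - 2 - (u + 1) = k - 3 - u by omega]
      ring
  · cases u with
    | zero => simp [altSum_zero, scaledOfficialGF]
    | succ u =>
      have h1 := dvd_mul_sub_mul (X_pow_dvd_qInf_sub J)
        (dvd_mul_of_dvd_right (X_pow_dvd_officialGF_sub_one hk J u)
          (∏ j ∈ Finset.range J, (1 + X ^ (j + 1) : PowerSeries ℂ)) |>.trans
            (dvd_of_eq (mul_sub_one _ _)))
      have h2 := X_pow_dvd_altSum_sub hk (Nat.succ_pos u) J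
      have h3 : (∏ s ∈ Finset.range J, (1 - X ^ (s + 1) : PowerSeries ℂ)) *
          (∏ j ∈ Finset.range J, (1 + X ^ (j + 1))) =
            ∏ s ∈ Finset.range J, (1 - X ^ (2 * (s + 1))) := by
        rw [← Finset.prod_mul_distrib]
        refine Finset.prod_congr rfl fun s _ => ?_
        rw [two_mul, pow_add]
        ring
      rw [h3] at h1
      have h4 := dvd_sub h1 h2
      rw [sub_sub_sub_cancel_right, ← mul_assoc] at h4
      exact h4

/-! ### Gaussian binomial coefficients -/

section Gauss

variable {R : Type*} [CommRing R]

/-- The Gaussian binomial coefficient with parameter `y`, by the recursion of Pascal's triangle. -/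
def gaussBinom (y : R) : ℕ → ℕ → R
  | _, 0 => 1
  | 0, _ + 1 => 0
  | M + 1, j + 1 => gaussBinom y M j + y ^ (j + 1) * gaussBinom y M (j + 1)

/-- The finite product `(1 - y) (1 - y ^ 2) ⋯ (1 - y ^ n)`. -/
def qFact (y : R) (n : ℕ) : R := ∏ s ∈ Finset.range n, (1 - y ^ (s + 1))

theorem gaussBinom_zero_right (y : R) (M : ℕ) : gaussBinom y M 0 = 1 := by
  cases M <;> rfl

theorem gaussBinom_eq_zero (y : R) {M j : ℕ} (h : M < j) : gaussBinom y M j = 0 := by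
  induction M generalizing j with
  | zero =>
    cases j with
    | zero => omega
    | succ j => rfl
  | succ M ih =>
    cases j with
    | zero => omega
    | succ j => rw [gaussBinom, ih (by omega), ih (by omega), mul_zero, add_zero]

theorem gaussBinom_self (y : R) (n : ℕ) : gaussBinom y n n = 1 := by
  induction n with
  | zero => rfl
  | succ n ih => rw [gaussBinom, ih, gaussBinom_eq_zero y (Nat.lt_succ_self n), mul_zero, add_zero]

/-- The second form of the recursion of Pascal's triangle. -/
theorem gaussBinom_succ_succ' (y : R) {M j : ℕ} (h : j ≤ M) :
    gaussBinom y (M + 1) (j + 1) = y ^ (M - j) * gaussBinom y M j + gaussBinom y M (j + 1) := by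
  induction M generalizing j with
  | zero =>
    obtain rfl : j = 0 := by omega
    simp [gaussBinom]
  | succ M ih =>
    rw [gaussBinom]
    cases j with
    | zero =>
      have h1 := ih (Nat.zero_le M)
      have h2 : gaussBinom y (M + 1) (0 + 1) =
        gaussBinom y M 0 + y ^ (0 + 1) * gaussBinom y M (0 + 1) := rfl
      simp only [gaussBinom_zero_right, Nat.sub_zero, pow_succ] at h1 h2 ⊢
      linear_combination y * h1 - h2
    | succ j =>
      have h3 : gaussBinom y (M + 1) (j + 1) =
        gaussBinom y M j + y ^ (j + 1) * gaussBinom y M (j + 1) := rfl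
      have h4 : gaussBinom y (M + 1) (j + 1 + 1) =
        gaussBinom y M (j + 1) + y ^ (j + 1 + 1) * gaussBinom y M (j + 1 + 1) := rfl
      have h1 := ih (j := j) (by omega)
      rcases Nat.lt_or_ge M (j + 1) with hj | hj
      · obtain rfl : j = M := by omega
        rw [gaussBinom_eq_zero y (M := j + 1) (j := j + 1 + 1) (by omega), Nat.sub_self]
        ring
      · have h2 := ih (j := j + 1) hj
        obtain ⟨a, rfl⟩ := Nat.exists_eq_add_of_le hj
        rw [show j + 1 + a - j = a + 1 by omega] at h1
        rw [show j + 1 + a - (j + 1) = a by omega] at h2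
        rw [show j + 1 + a + 1 - (j + 1) = a + 1 by omega]
        have h5 : (y : R) ^ (j + 1 + 1) * y ^ a = y ^ (a + 1) * y ^ (j + 1) := by ring
        linear_combination h1 + y ^ (j + 1 + 1) * h2 - y ^ (a + 1) * h3 - h4 +
          gaussBinom y (j + 1 + a) (j + 1) * h5

theorem qFact_succ (y : R) (n : ℕ) : qFact y (n + 1) = qFact y n * (1 - y ^ (n + 1)) :=
  Finset.prod_range_succ _ _

theorem gaussBinom_mul_qFact (y : R) (j l : ℕ) :
    gaussBinom y (j + l) j * (qFact y j * qFact y l) = qFact y (j + l) := by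
  induction j generalizing l with
  | zero => simp [gaussBinom_zero_right, qFact]
  | succ j ihj =>
    induction l with
    | zero => simp [gaussBinom_self, qFact]
    | succ l ihl =>
      have h1 := ihj (l + 1)
      have h2 : gaussBinom y (j + 1 + (l + 1)) (j + 1) =
        gaussBinom y (j + (l + 1)) j + y ^ (j + 1) * gaussBinom y (j + 1 + l) (j + 1) := by
          rw [show j + 1 + (l + 1) = j + (l + 1) + 1 by ring, gaussBinom,
            show j + (l + 1) = j + 1 + l by ring]
      rw [show j + 1 + (l + 1) = j + 1 + l + 1 by ring, qFact_succ y (j + 1 + l)]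
      rw [show j + 1 + (l + 1) = j + 1 + l + 1 by ring] at h2
      rw [show j + (l + 1) = j + 1 + l by ring] at h1 h2
      rw [h2, qFact_succ y j, qFact_succ y l]
      rw [qFact_succ y l] at h1
      rw [qFact_succ y j] at ihl
      linear_combination (1 - y ^ (j + 1)) * h1 + y ^ (j + 1) * (1 - y ^ (l + 1)) * ihl

/-- A factor `1 - c` that shifts the coefficients `t` of a sum of Gaussian binomial coefficients to
the right. -/
theorem one_sub_mul_sum_gaussBinom (y c : R) (M : ℕ) (t : ℕ → R)
    (h : ∀ j ≤ M, c * t j = -(y ^ (M - j) * t (j + 1))) :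
    (1 - c) * ∑ j ∈ Finset.range (M + 1), t j * gaussBinom y M j =
      ∑ j ∈ Finset.range (M + 2), t j * gaussBinom y (M + 1) j := by
  have h1 : ∑ j ∈ Finset.range (M + 1), t j * gaussBinom y M j =
      ∑ j ∈ Finset.range (M + 1), t (j + 1) * gaussBinom y M (j + 1) +
        t 0 * gaussBinom y (M + 1) 0 := by
    rw [gaussBinom_zero_right, ← gaussBinom_zero_right y M, ← Finset.sum_range_succ'
      (fun j => t j * gaussBinom y M j), Finset.sum_range_succ _ (M + 1),
      gaussBinom_eq_zero y (Nat.lt_succ_self M), mul_zero, add_zero]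
  rw [Finset.sum_range_succ' _ (M + 1), sub_mul, one_mul]
  nth_rewrite 1 [h1]
  rw [add_sub_right_comm, Finset.mul_sum, ← Finset.sum_sub_distrib]
  congr 1
  refine Finset.sum_congr rfl fun j hj => ?_
  have hj' : j ≤ M := by
    rw [Finset.mem_range] at hj
    omega
  rw [gaussBinom_succ_succ' y hj']
  linear_combination -gaussBinom y M j * h j hj'

/-- A factor `1 - c` that shifts the coefficients `t` of a sum of Gaussian binomial coefficients to
the left, so that they have to be indexed anew, by `t'`. -/
theorem one_sub_mul_sum_gaussBinom' (y c : R) (M : ℕ) (t t' : ℕ → R)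
    (ht : ∀ j, t' (j + 1) = t j) (h : ∀ j ≤ M, c * t j = -(y ^ j * t' j)) :
    (1 - c) * ∑ j ∈ Finset.range (M + 1), t j * gaussBinom y M j =
      ∑ j ∈ Finset.range (M + 2), t' j * gaussBinom y (M + 1) j := by
  have h1 : ∑ j ∈ Finset.range (M + 1), y ^ j * t' j * gaussBinom y M j =
      ∑ j ∈ Finset.range (M + 1), y ^ (j + 1) * t' (j + 1) * gaussBinom y M (j + 1) +
        t' 0 * gaussBinom y (M + 1) 0 := by
    have e : t' 0 * gaussBinom y (M + 1) 0 = y ^ 0 * t' 0 * gaussBinom y M 0 := by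
      simp [gaussBinom_zero_right]
    rw [e, ← Finset.sum_range_succ' (fun j => y ^ j * t' j * gaussBinom y M j),
      Finset.sum_range_succ _ (M + 1), gaussBinom_eq_zero y (Nat.lt_succ_self M), mul_zero, add_zero]
  have h2 : c * ∑ j ∈ Finset.range (M + 1), t j * gaussBinom y M j =
      -∑ j ∈ Finset.range (M + 1), y ^ j * t' j * gaussBinom y M j := by
    rw [Finset.mul_sum, ← Finset.sum_neg_distrib]
    refine Finset.sum_congr rfl fun j hj => ?_
    rw [Finset.mem_range] at hj
    linear_combination gaussBinom y M j * h j (by omega)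
  rw [Finset.sum_range_succ' _ (M + 1), sub_mul, one_mul, h2, h1, sub_neg_eq_add, ← add_assoc,
    ← Finset.sum_add_distrib]
  congr 1
  refine Finset.sum_congr rfl fun j _ => ?_
  rw [gaussBinom, ht]
  ring

end Gauss

/-! ### The triple product -/

/-- The exponent `k n² + d n`, for an integer `n`. -/
def quadExp (k d : ℕ) (n : ℤ) : ℕ := (k * n ^ 2 + d * n).toNat

theorem cast_quadExp {k d : ℕ} (h : d ≤ k) (n : ℤ) : (quadExp k d n : ℤ) = k * n ^ 2 + d * n := by
  refine Int.toNat_of_nonneg ?_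
  have hd : (d : ℤ) ≤ k := by exact_mod_cast h
  have hd0 : (0 : ℤ) ≤ d := Int.natCast_nonneg d
  have h1 : -n ≤ n ^ 2 := by
    rcases le_or_gt 0 n with hn | hn <;> nlinarith
  nlinarith [mul_nonneg (sub_nonneg.2 hd) (sq_nonneg n), mul_nonneg hd0 (sub_nonneg.2 h1)]

/-- The finite form of the triple product identity, with an arbitrary number of factors of either
kind. -/
theorem prod_mul_prod_eq_sum_gaussBinom {k d u : ℕ} (h : d + u = k) (a b : ℕ) :
    (∏ m ∈ Finset.range a, (1 - X ^ (2 * k * m + k + d))) *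
      (∏ m ∈ Finset.range b, (1 - X ^ (2 * k * m + u) : PowerSeries ℂ)) =
    ∑ j ∈ Finset.range (a + b + 1),
      (-1) ^ (j + b) * X ^ quadExp k d (j - b) * gaussBinom (X ^ (2 * k)) (a + b) j := by
  have hdk : d ≤ k := by omega
  have hk : (k : ℤ) = d + u := by exact_mod_cast h.symm
  induction a with
  | zero =>
    induction b with
    | zero => simp [quadExp, gaussBinom_zero_right]
    | succ b ih =>
      rw [Finset.prod_range_succ, ← mul_assoc, ih, mul_comm, zero_add, zero_add]
      refine one_sub_mul_sum_gaussBinom' _ _ b _ _ (fun j => ?_) (fun j hj => ?_)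
      · rw [show j + 1 + (b + 1) = j + b + 2 by ring, pow_add _ (j + b) 2]
        push_cast
        rw [show (j : ℤ) + 1 - (b + 1) = j - b by ring]
        ring
      · have e : 2 * k * b + u + quadExp k d (j - b) =
            2 * k * j + quadExp k d (j - (b + 1 : ℕ)) := by
          zify
          rw [cast_quadExp hdk, cast_quadExp hdk, hk]
          ring
        rw [← pow_mul, mul_left_comm, ← pow_add, e, pow_add]
        ring
  | succ a ih =>
    rw [Finset.prod_range_succ, mul_right_comm, ih, mul_comm,
      show a + 1 + b = a + b + 1 by ring]
    refine one_sub_mul_sum_gaussBinom _ _ (a + b) _ (fun j hj => ?_)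
    have e : 2 * k * a + k + d + quadExp k d (j - b) =
        2 * k * (a + b - j) + quadExp k d ((j + 1 : ℕ) - b) := by
      zify [hj]
      rw [cast_quadExp hdk, cast_quadExp hdk]
      ring
    rw [← pow_mul, mul_left_comm, ← pow_add, e, pow_add]
    ring

theorem dvd_qFact_sub {R : Type*} [CommRing R] (y : R) {w n : ℕ} (h : w ≤ n) :
    y ^ w ∣ qFact y n - qFact y w := by
  induction n, h using Nat.le_induction with
  | base => simp
  | succ n hn ih =>
    rw [qFact_succ, mul_one_sub, sub_right_comm]
    exact dvd_sub ih (dvd_mul_of_dvd_right (pow_dvd_pow y (by omega)) _)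

theorem isUnit_qFact {k : ℕ} (hk : 1 ≤ k) (n : ℕ) :
    IsUnit (qFact (X ^ (2 * k)) n : PowerSeries ℂ) := by
  rw [isUnit_iff_constantCoeff, qFact, map_prod]
  have : 2 * k ≠ 0 := by omega
  simp [this]

/-- The Gaussian binomial coefficients tend to the inverse of an infinite product. -/
theorem dvd_qFact_mul_gaussBinom_sub_one {k w N j l : ℕ} (hk : 1 ≤ k) (hN : w ≤ N) (hj : w ≤ j)
    (hl : w ≤ l) :
    (X ^ (2 * k)) ^ w ∣
      qFact (X ^ (2 * k)) N * gaussBinom (X ^ (2 * k)) (j + l) j - (1 : PowerSeries ℂ) := by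
  set y : PowerSeries ℂ := X ^ (2 * k) with hy
  set g := gaussBinom y (j + l) j with hg
  have h1 : y ^ w ∣ g * (qFact y j * qFact y l) - g * (qFact y w * qFact y w) := by
    rw [← mul_sub]
    exact dvd_mul_of_dvd_right (dvd_mul_sub_mul (dvd_qFact_sub y hj) (dvd_qFact_sub y hl)) _
  rw [hg, gaussBinom_mul_qFact, ← hg] at h1
  have h2 := dvd_sub (dvd_qFact_sub y (show w ≤ j + l by omega)) h1
  have h3 : y ^ w ∣ qFact y w * (qFact y w * g - 1) := by
    convert h2 using 1
    ring
  rw [(isUnit_qFact hk w).dvd_mul_left] at h3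
  have h4 := dvd_add h3 (dvd_mul_of_dvd_left (dvd_qFact_sub y hN) g)
  convert h4 using 1
  ring

theorem quadExp_natCast (k d n : ℕ) : quadExp k d n = k * n ^ 2 + d * n := by
  unfold quadExp
  exact_mod_cast Int.toNat_natCast _

theorem quadExp_neg_succ {k d u : ℕ} (h : d + u = k) (n : ℕ) :
    quadExp k d (-(n + 1)) = k * n ^ 2 + d * n + u * (2 * n + 1) := by
  zify
  rw [cast_quadExp (by omega)]
  subst h
  push_cast
  ring

/-- The triple product identity, for the numerators of the product sides. -/
theorem numProd_eq_altSum {k i : ℕ} (hi : 1 ≤ i) (hik : i ≤ k) :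
    numProd k i = altSum k 0 (k - i + 1) := by
  obtain ⟨d, rfl⟩ := Nat.exists_eq_add_of_le' hi
  obtain ⟨u, hu⟩ : ∃ u, k - (d + 1) + 1 = u := ⟨_, rfl⟩
  have hdu : d + u = k := by omega
  have hk : 1 ≤ k := by omega
  rw [hu]
  set y : PowerSeries ℂ := X ^ (2 * k) with hy
  refine eq_of_forall_X_pow_dvd_sub fun N => ?_
  have hsum : X ^ N ∣ altSum k 0 u - ∑ n ∈ Finset.range N, altTerm k 0 d u n := by
    rw [altSum, show k - u = d by omega]
    refine X_pow_dvd_tsum_sub (summable_altTerm hk 0 d u) fun n hn => ?_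
    refine (pow_dvd_pow X ?_).trans (X_pow_dvd_altTerm hk 0 d u n)
    have : n ≤ n ^ 2 := Nat.le_self_pow two_ne_zero n
    omega
  have hprod : X ^ N ∣ numProd k (d + 1) - qFact y N *
      ((∏ m ∈ Finset.range N, (1 - X ^ (2 * k * m + k + d))) *
        (∏ m ∈ Finset.range N, (1 - X ^ (2 * k * m + u)))) := by
    have e : qFact y N * ((∏ m ∈ Finset.range N, (1 - X ^ (2 * k * m + k + d))) *
        (∏ m ∈ Finset.range N, (1 - X ^ (2 * k * m + u)))) =
        ∏ m ∈ Finset.range N, ((1 - X ^ (2 * k * (m + 1))) *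
          (1 - X ^ (2 * k * (m + 1) - k + (d + 1) - 1)) *
            (1 - X ^ (2 * k * (m + 1) - k - (d + 1) + 1))) := by
      rw [qFact, ← Finset.prod_mul_distrib, ← Finset.prod_mul_distrib]
      refine Finset.prod_congr rfl fun m _ => ?_
      have e0 : 2 * k * (m + 1) = 2 * k * m + 2 * k := by ring
      rw [hy, ← pow_mul, ← mul_assoc, show 2 * k * (m + 1) - k + (d + 1) - 1 = 2 * k * m + k + d by
        omega, show 2 * k * (m + 1) - k - (d + 1) + 1 = 2 * k * m + u by omega]
    rw [e]
    refine X_pow_dvd_tprod_sub (multipliable_numProd k (d + 1) hi hik) fun n hn => ?_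
    have hX : ∀ a, n ≤ a → (X : PowerSeries ℂ) ^ N ∣ (1 - X ^ a) - 1 := fun a ha => by
      rw [sub_sub_cancel_left, dvd_neg]
      exact pow_dvd_pow X (by omega)
    have e0 : 2 * k * (n + 1) = 2 * k * n + 2 * k := by ring
    have e1 : 1 * n ≤ 2 * k * n := Nat.mul_le_mul_right n (by omega)
    have := dvd_mul_sub_mul (dvd_mul_sub_mul (hX (2 * k * (n + 1)) (by omega))
      (hX (2 * k * (n + 1) - k + (d + 1) - 1) (by omega)))
      (hX (2 * k * (n + 1) - k - (d + 1) + 1) (by omega))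
    simpa only [mul_one] using this
  rw [prod_mul_prod_eq_sum_gaussBinom hdu, Finset.sum_range_succ, Finset.sum_range_add,
    ← Finset.sum_range_reflect, ← Finset.sum_add_distrib] at hprod
  -- The summands with the indices `N + n` and `N - 1 - n` together give the `n`-th term.
  have hexp : ∀ n, n ≤ k * n ^ 2 + d * n := fun n => by
    have h1 : n ≤ n ^ 2 := Nat.le_self_pow two_ne_zero n
    have h2 : 1 * n ^ 2 ≤ k * n ^ 2 := Nat.mul_le_mul_right _ hk
    omega
  -- Times `qFact y N`, the Gaussian coefficient is `1` modulo `y ^ w` if `j` has distance at least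
  -- `w` from the ends of the range; the power `X ^ e` supplies the remaining divisibility.
  have happrox : ∀ {e w j l M : ℕ}, j + l = M → w ≤ N → w ≤ j → w ≤ l → N ≤ e + w →
      X ^ N ∣ X ^ e * (qFact y N * gaussBinom y M j - 1) := by
    rintro e w j l M rfl h1 h2 h3 h4
    refine (pow_dvd_pow X h4).trans ?_
    rw [pow_add]
    refine mul_dvd_mul_left _ (dvd_trans ?_ (dvd_qFact_mul_gaussBinom_sub_one hk h1 h2 h3))
    exact pow_dvd_pow_of_dvd (dvd_pow_self X (by omega)) w
  have hterm : ∀ n ∈ Finset.range N, X ^ N ∣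
      qFact y N * ((-1) ^ (N - 1 - n + N) * X ^ quadExp k d ((N - 1 - n : ℕ) - N) *
          gaussBinom y (N + N) (N - 1 - n) +
        (-1) ^ (N + n + N) * X ^ quadExp k d ((N + n : ℕ) - N) * gaussBinom y (N + N) (N + n)) -
      altTerm k 0 d u n := by
    intro n hn
    rw [Finset.mem_range] at hn
    have e1 : ((N - 1 - n : ℕ) : ℤ) - N = -(n + 1) := by omega
    have e2 : ((N + n : ℕ) : ℤ) - N = n := by omega
    have s1 : (-1 : PowerSeries ℂ) ^ (N - 1 - n + N) = -(-1) ^ n := by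
      rw [show N - 1 - n + N = 2 * (N - 1 - n) + (n + 1) by omega, pow_add, pow_mul]
      simp [pow_succ]
    have s2 : (-1 : PowerSeries ℂ) ^ (N + n + N) = (-1) ^ n := by
      rw [show N + n + N = 2 * N + n by ring, pow_add, pow_mul]
      simp
    have h1 := happrox (e := k * n ^ 2 + d * n + u * (2 * n + 1)) (w := N - 1 - n)
      (j := N - 1 - n) (l := N + 1 + n) (M := N + N) (by omega) (by omega) le_rfl (by omega) (by
        have := hexp n
        have : 1 * 1 ≤ u * (2 * n + 1) := Nat.mul_le_mul (by omega) (by omega)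
        omega)
    have h2 := happrox (e := k * n ^ 2 + d * n) (w := N - n) (j := N + n) (l := N - n)
      (M := N + N) (by omega) (by omega) (by omega) le_rfl (by
        have := hexp n
        omega)
    rw [e1, e2, quadExp_natCast, quadExp_neg_succ hdu, s1, s2]
    have h3 := dvd_sub (dvd_mul_of_dvd_right h2 ((-1) ^ n)) (dvd_mul_of_dvd_right h1 ((-1) ^ n))
    convert h3 using 1
    simp only [altTerm, Finset.range_zero, Finset.prod_empty, zero_mul, zero_add, add_zero, pow_add]
    ring
  have hlast : X ^ N ∣ qFact y N * ((-1) ^ (N + N + N) * X ^ quadExp k d ((N + N : ℕ) - N) *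
      gaussBinom y (N + N) (N + N)) := by
    refine dvd_mul_of_dvd_right (dvd_mul_of_dvd_left (dvd_mul_of_dvd_right (pow_dvd_pow X ?_) _) _) _
    rw [show ((N + N : ℕ) : ℤ) - N = N by omega, quadExp_natCast]
    exact hexp N
  have hall := dvd_sub (dvd_add (dvd_add hprod (Finset.dvd_sum hterm)) hlast) hsum
  convert hall using 1
  rw [Finset.sum_sub_distrib, ← Finset.mul_sum]
  ring

/-! ### The series of the shelves as generating functions -/

theorem qInf_ne_zero : qInf ≠ 0 := by
  intro h
  have h1 := X_pow_dvd_qInf_sub 0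
  rw [h, X_pow_dvd_iff] at h1
  simpa using h1 0 (by omega)

theorem coe_one_add_X_pow (j : ℕ) :
    ((1 + X ^ (j + 1) : PowerSeries ℂ) : LaurentSeries ℂ) = 1 + q ^ (j + 1) := by
  simp [q]

theorem zerothShelf_eq {k i : ℕ} (hk : 2 ≤ k) (hi : 1 ≤ i) (hik : i ≤ k) :
    zerothShelf k i = (officialGF k 0 (k - i) : LaurentSeries ℂ) := by
  have h := scaledOfficialGF_eq_altSum hk (u := k - i + 1) (by omega) 0
  rw [← numProd_eq_altSum hi hik] at h
  have hq : (qInf : LaurentSeries ℂ) ≠ 0 := fun h0 =>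
    qInf_ne_zero (HahnSeries.ofPowerSeries_injective (h0.trans (map_zero _).symm))
  rw [zerothShelf, div_eq_iff hq, ← h, scaledOfficialGF, Finset.prod_range_zero, mul_one, mul_comm,
    PowerSeries.coe_mul]

/-- If the official series of a shelf are the official generating functions, then its ghost series
are the ghost generating functions. -/
theorem ghostOfShelf_eq {k j : ℕ} {b : ℕ → LaurentSeries ℂ}
    (hb : ∀ i, 1 ≤ i → i ≤ k → b i = (officialGF k j (k - i) : LaurentSeries ℂ)) {i : ℕ}
    (hi : 2 ≤ i) (hik : i ≤ k) :
    ghostOfShelf k j b i = (ghostGF k j (k - i) : LaurentSeries ℂ) := by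
  have h1 := one_add_q_pow_ne_zero j
  unfold ghostOfShelf
  split_ifs with h
  · subst h
    rw [div_eq_iff h1, hb _ (by omega) (by omega), show i - (i - 1) = 1 by omega, Nat.sub_self,
      ← ghostGF_zero_relation hi, PowerSeries.coe_mul, coe_one_add_X_pow, mul_comm]
  · obtain ⟨m, hm⟩ : ∃ m, k - i = m + 1 := ⟨k - i - 1, by omega⟩
    rw [div_eq_iff h1, hb _ (by omega) (by omega), hb _ (by omega) (by omega),
      show k - (i - 1) = m + 2 by omega, show k - (i + 1) = m by omega, hm, ← coe_one_add_X_pow,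
      ← PowerSeries.coe_mul, mul_comm (ghostGF k j (m + 1)), ghostGF_succ_relation (by omega)]
    simp [q]

theorem officialShelf_eq {k i : ℕ} (j : ℕ) (hk : 2 ≤ k) (hi : 1 ≤ i) (hik : i ≤ k) :
    officialShelf k j i = (officialGF k j (k - i) : LaurentSeries ℂ) := by
  induction j generalizing i with
  | zero => exact zerothShelf_eq hk hi hik
  | succ j ih =>
    unfold officialShelf
    split_ifs with h
    · subst h
      rw [ih (by omega) le_rfl, Nat.sub_self, officialGF_zero (by omega)]
    · obtain ⟨m, rfl⟩ : ∃ m, i = m + 2 := ⟨i - 2, by omega⟩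
      rw [ih (by omega) (by omega), ghostOfShelf_eq (fun i => ih) (by omega) (by omega),
        div_eq_iff (pow_ne_zero _ q_ne_zero), show k - (k - (m + 2) + 1) = m + 1 by omega,
        show k - (k - (m + 2) + 2) = m by omega, officialGF_succ hik,
        show k - 2 - m = k - (m + 2) by omega]
      simp [q, mul_comm]

end GhostSeries

theorem mainTheorem3 (k : ℕ) (hk : 2 ≤ k) (J i r : ℕ) (hi : 2 ≤ i) (hik : i ≤ k)
    (hr : r = (k - 1) * J + i) :
    GhostSeries.ghost k r =
      ((PowerSeries.mk fun n => (GhostSeries.ghostCount k J i n : ℂ) : PowerSeries ℂ) :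
        LaurentSeries ℂ) := by
  rw [hr, GhostSeries.ghost_eq k J i hi hik, GhostSeries.mk_ghostCount hk J hik]
  exact GhostSeries.ghostOfShelf_eq
    (fun i' hi' hik' => GhostSeries.officialShelf_eq J hk hi' hik') hi hik
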